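/- Let $K$ be an algebraically closed field of arbitrary characteristic. A plane algebroid curve $C:\{f=0\}$ is the ideal generated in $K[[x,y]]$ by a nonzero power series $f$ without constant term; its multiplicity $m(C)$ is the order of $f$. The curve is reduced if $f$ has no multiple factors, and it is a branch if $f$ is irreducible; the branches of $C$ are the curves $\{p=0\}$ with $p$ an irreducible factor of $f$. For $D:\{g=0\}$ put $(C,D)_0=\dim_K K[[x,y]]/(f,g)$. For branches $C,D$ let $d(C,D)=\frac{(C,D)_0}{m(C)\,m(D)}\in[0,+\infty]$ (so $d(C,C)=+\infty$), and for reduced curves with branches $C_i$ and $D_j$ let $d(C,D)=\inf_{i,j}d(C_i,D_j)$. The semigroup of a branch $W:\{f=0\}$ is $\Gamma(W)=\{\dim_K K[[x,y]]/(f,g) : g\in K[[x,y]],\ g\not\equiv 0 \pmod f\}$. Its minimal system of generators $v_0,\dots,v_g$ is given by $v_0=\min(\Gamma(W)\setminus\{0\})$, $v_l=\min\bigl(\Gamma(W)\setminus(\mathbb N v_0+\cdots+\mathbb N v_{l-1})\bigr)$ for $1\le l\le g$, and $\Gamma(W)=\mathbb N v_0+\cdots+\mathbb N v_g$. With $e_l=\gcd(v_0,\dots,v_l)$,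 the branch $W$ has the $g$ Zariski pairs $\left(\frac{v_l}{e_l},\frac{e_{l-1}}{e_l}\right)$, $1\le l\le g$. For an integer $k\ge 1$ let $\mathcal B_k$ be the family of branches having at most $k-1$ Zariski pairs, and for a reduced curve $C$ put $d_k(C)=\sup\{d(C,W) : W\in\mathcal B_k\}\in[0,+\infty]$. **Proposition.** Let $C$ be a reduced curve with $r>1$ (pairwise distinct) branches $C_1,\dots,C_r$. Then for every integer $k\ge 1$ $$d_k(C)=\inf\Bigl\{\inf_{1\le i\le r} d_k(C_i),\ \inf_{1\le i,j\le r} d(C_i,C_j)\Bigr\}.$$ -/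

import Mathlib

open scoped ENNReal

/-- The ring `K[[x, y]]` of formal power series in two variables. -/
abbrev Series2 (K : Type*) := MvPowerSeries (Fin 2) K

/-- A plane algebroid curve `{f = 0}`: the ideal of `K[[x, y]]` generated by a nonzero power
series `f` without constant term. -/
@[ext]
structure AlgebroidCurve (K : Type*) [Field K] where
  ideal : Ideal (Series2 K)
  exists_equation : ∃ f : Series2 K,
    f ≠ 0 ∧ MvPowerSeries.constantCoeff f = 0 ∧ ideal = Ideal.span {f}

namespace AlgebroidCurve

variable {K : Type*} [Field K]

/-- The curve `{f = 0}`. -/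
noncomputable def ofSeries (f : Series2 K) (hf : f ≠ 0) (h0 : MvPowerSeries.constantCoeff f = 0) :
    AlgebroidCurve K :=
  ⟨Ideal.span {f}, f, hf, h0, rfl⟩

/-- The curve is reduced: its equation has no multiple factors. -/
def IsReduced (C : AlgebroidCurve K) : Prop :=
  ∃ f : Series2 K, Squarefree f ∧ C.ideal = Ideal.span {f}

/-- The curve is a branch: its equation is irreducible. -/
def IsBranch (C : AlgebroidCurve K) : Prop :=
  ∃ f : Series2 K, Irreducible f ∧ C.ideal = Ideal.span {f}

/-- The multiplicity `m(C)`, which is the order of an equation of `C`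
(see `multiplicity_eq_order`), i.e. the least order of an element of the ideal. -/
noncomputable def multiplicity (C : AlgebroidCurve K) : ℕ∞ :=
  ⨅ f ∈ C.ideal, MvPowerSeries.order f

theorem multiplicity_eq_order (C : AlgebroidCurve K) (f : Series2 K)
    (h : C.ideal = Ideal.span {f}) : C.multiplicity = MvPowerSeries.order f := by
  apply le_antisymm
  · exact iInf₂_le f (h ▸ Ideal.mem_span_singleton_self f)
  · refine le_iInf₂ fun g hg => ?_
    rw [h, Ideal.mem_span_singleton] at hg
    obtain ⟨c, rfl⟩ := hg
    exact le_trans le_self_add MvPowerSeries.le_order_mul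

/-- The irreducible components (branches) of a curve: for `C : {f = 0}` these are the branches
`{p = 0}` with `p` an irreducible factor of `f`. -/
def components (C : AlgebroidCurve K) : Set (AlgebroidCurve K) :=
  {B | B.IsBranch ∧ C.ideal ≤ B.ideal}

/-- The dimension over `K` of `K[[x, y]] / I`, in `ℕ ∪ {∞}`. -/
noncomputable def codim (I : Ideal (Series2 K)) : ℕ∞ :=
  Cardinal.toENat (Module.rank K (Series2 K ⧸ I))

/-- The intersection number `(C, D)₀ = dim_K K[[x, y]] / (f, g)` for `C : {f = 0}` and
`D : {g = 0}`. -/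
noncomputable def intersectionNumber (C D : AlgebroidCurve K) : ℕ∞ :=
  codim (C.ideal ⊔ D.ideal)

/-- The order of contact `d(C, D) = (C, D)₀ / (m(C) m(D))` of two branches. -/
noncomputable def orderOfContact (C D : AlgebroidCurve K) : ℝ≥0∞ :=
  (intersectionNumber C D : ℝ≥0∞) / ((C.multiplicity : ℝ≥0∞) * (D.multiplicity : ℝ≥0∞))

/-- The order of contact of two reduced curves: the infimum of the orders of contact of their
irreducible components. -/
noncomputable def contact (C D : AlgebroidCurve K) : ℝ≥0∞ :=
  ⨅ A ∈ C.components, ⨅ B ∈ D.components, orderOfContact A B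

theorem IsBranch.components_eq {C : AlgebroidCurve K} (hC : C.IsBranch) :
    C.components = {C} := by
  obtain ⟨f, hf, hCf⟩ := hC
  ext B
  constructor
  · rintro ⟨⟨g, hg, hBg⟩, hle⟩
    have hdvd : g ∣ f := by
      rw [hCf, hBg, Ideal.span_singleton_le_span_singleton] at hle
      exact hle
    have : Associated g f := hg.associated_of_dvd hf hdvd
    rw [Set.mem_singleton_iff]
    apply AlgebroidCurve.ext
    rw [hBg, hCf]
    exact le_antisymm (Ideal.span_singleton_le_span_singleton.2 this.symm.dvd)
      (Ideal.span_singleton_le_span_singleton.2 this.dvd)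
  · rintro rfl
    exact ⟨⟨f, hf, hCf⟩, le_rfl⟩

/-- On branches the two notions of contact agree. -/
theorem IsBranch.contact_eq {C D : AlgebroidCurve K} (hC : C.IsBranch) (hD : D.IsBranch) :
    contact C D = orderOfContact C D := by
  simp [contact, hC.components_eq, hD.components_eq]

/-- The semigroup `Γ(C)` of a branch `C : {f = 0}`: the set of all intersection numbers
`(f, g)₀` with `g ≢ 0 (mod f)`. -/
def semigroup (C : AlgebroidCurve K) : Set ℕ :=
  {n | ∃ g : Series2 K, g ∉ C.ideal ∧ codim (C.ideal ⊔ Ideal.span {g}) = (n : ℕ∞)}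

end AlgebroidCurve

/-- `v 0, …, v g` is the minimal system of generators of `Γ ⊆ ℕ`: `v 0` is the least nonzero
element of `Γ`, each further `v k` is the least element of `Γ` outside
`ℕ v 0 + ⋯ + ℕ v (k - 1)`, and `Γ = ℕ v 0 + ⋯ + ℕ v g`. -/
structure IsMinimalSystem (Γ : Set ℕ) {g : ℕ} (v : Fin (g + 1) → ℕ) : Prop where
  zero : IsLeast (Γ \ {0}) (v 0)
  step : ∀ k : Fin (g + 1), k ≠ 0 →
    IsLeast (Γ \ (AddSubmonoid.closure (v '' Set.Iio k) : Set ℕ)) (v k)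
  generate : Γ = (AddSubmonoid.closure (Set.range v) : Set ℕ)

/-- `e k = gcd (v 0, …, v k)`. -/
def partialGcd {g : ℕ} (v : Fin (g + 1) → ℕ) (k : Fin (g + 1)) : ℕ :=
  (Finset.Iic k).gcd v

/-- The `g` Zariski pairs `(v k / e k, e (k - 1) / e k)`, `1 ≤ k ≤ g`; the pair of index `k` is
stored at the position `k - 1` of `Fin g`. -/
def zariskiPairs {g : ℕ} (v : Fin (g + 1) → ℕ) (k : Fin g) : ℕ × ℕ :=
  (v k.succ / partialGcd v k.succ, partialGcd v k.castSucc / partialGcd v k.succ)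

namespace AlgebroidCurve

variable {K : Type*} [Field K]

/-- `z` is the sequence of the Zariski pairs of the branch `C`. -/
def HasZariskiPairs (C : AlgebroidCurve K) {g : ℕ} (z : Fin g → ℕ × ℕ) : Prop :=
  ∃ v : Fin (g + 1) → ℕ, IsMinimalSystem C.semigroup v ∧ z = zariskiPairs v

/-- The family `ℬ_k` of the branches having at most `k - 1` (that is, fewer than `k`)
Zariski pairs. -/
def branchFamily (K : Type*) [Field K] (k : ℕ) : Set (AlgebroidCurve K) :=
  {W | W.IsBranch ∧ ∃ g : ℕ, g < k ∧ ∃ z : Fin g → ℕ × ℕ, W.HasZariskiPairs z}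

/-- The contact exponent of order `k`: `d_k(C) = sup {d(C, W) : W ∈ ℬ_k}`. -/
noncomputable def contactExponent (k : ℕ) (C : AlgebroidCurve K) : ℝ≥0∞ :=
  ⨆ W ∈ branchFamily K k, contact C W

end AlgebroidCurve

/-! The proposition follows formally from the strong triangle inequality `min_orderOfContact_le` for
branches, and the argument works for any family of branches in place of ℬ_k. If W is in the family,
then d(C, W) is at most both d(C_i, W) and d(C_j, W), hence at most d(C_i, C_j). Conversely, if W
nearly realizes d_k of one branch C_0, then each d(C_j, W) is at least min(d(C_j, C_0), d(C_0, W)).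

For the triangle inequality, a general shear makes the Weierstrass polynomials F, G, H of three
branches have degrees equal to the multiplicities. The intersection number of F and G is the x-adic
order of the norm of G modulo F, that is, of the product of the differences α - β of their roots.
Let ν be the invariant extension of the absolute value of K((x)) to a splitting field L, and Γ =
Aut(L/K((x))). Averaging over Γ gives ∏_σ ν(α - σβ) = q^(|Γ| d) with 0 < q < 1 and d the order of
contact (`key` in `finrankQuotient_triangle`). These orbit products satisfy the ultrametric
inequality by `prod_dist_smul_le_max`. No separability is needed, so the characteristic is
arbitrary. -/

section

/-! ### Colength of a principal ideal as the order of a norm. -/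

namespace PowerSeries

variable {K : Type*} [Field K]

theorem ker_pi_coeff (n : ℕ) :
    LinearMap.ker (LinearMap.pi fun i : Fin n => (coeff (R := K) (i : ℕ))) =
      (Ideal.span {(X : K⟦X⟧) ^ n}).restrictScalars K := by
  ext f
  simp only [LinearMap.mem_ker, Submodule.restrictScalars_mem, Ideal.mem_span_singleton,
    X_pow_dvd_iff, funext_iff, LinearMap.pi_apply, Pi.zero_apply]
  exact ⟨fun h m hm => h ⟨m, hm⟩, fun h i => h i i.2⟩

/-- Truncation identifies `K⟦X⟧ / (X ^ n)` with `K ^ n`. -/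
noncomputable def quotientSpanXPowEquiv (n : ℕ) :
    (K⟦X⟧ ⧸ Ideal.span {(X : K⟦X⟧) ^ n}) ≃ₗ[K] (Fin n → K) :=
  (Submodule.Quotient.restrictScalarsEquiv K (Ideal.span {(X : K⟦X⟧) ^ n})).symm ≪≫ₗ
    Submodule.quotEquivOfEq _ _ (ker_pi_coeff n).symm ≪≫ₗ
    LinearMap.quotKerEquivOfSurjective _ (fun v => ⟨mk fun i => if h : i < n then v ⟨i, h⟩ else 0, by
      ext i; simp⟩)

theorem finite_quotient_span_singleton {a : K⟦X⟧} (ha : a ≠ 0) :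
    Module.Finite K (K⟦X⟧ ⧸ Ideal.span {a}) ∧
      Associated a (X ^ Module.finrank K (K⟦X⟧ ⧸ Ideal.span {a})) := by
  obtain ⟨n, h⟩ := IsDiscreteValuationRing.associated_pow_irreducible ha
    (X_irreducible (R := K))
  have e : (K⟦X⟧ ⧸ Ideal.span {a}) ≃ₗ[K] (Fin n → K) :=
    (Ideal.quotientEquivAlgOfEq K (Ideal.span_singleton_eq_span_singleton.2 h)).toLinearEquiv ≪≫ₗ
      quotientSpanXPowEquiv n
  refine ⟨Module.Finite.equiv e.symm, ?_⟩
  rwa [e.finrank_eq, Module.finrank_fin_fun]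

/-- By Smith normal form, S/(s) is the direct sum of the K⟦X⟧/(a_i), while the norm of s is the
product of the a_i up to a unit. Each a_i is a unit times X to the dimension of its summand. -/
theorem associated_norm_X_pow_finrank {S ι : Type*} [CommRing S] [IsDomain S] [Algebra K⟦X⟧ S]
    [Algebra K S] [IsScalarTower K K⟦X⟧ S] [Finite ι] (b : Module.Basis ι K⟦X⟧ S) {s : S}
    (hs : s ≠ 0) :
    Module.Finite K (S ⧸ Ideal.span {s}) ∧
      Associated (Algebra.norm K⟦X⟧ s) (X ^ Module.finrank K (S ⧸ Ideal.span {s})) := by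
  have := Fintype.ofFinite ι
  have h := Ideal.span_singleton_eq_bot.not.2 hs
  have hfin : ∀ i, Module.Finite K (K⟦X⟧ ⧸ Ideal.span {Ideal.smithCoeffs b _ h i}) := fun i =>
    (finite_quotient_span_singleton (Ideal.smithCoeffs_ne_zero b _ h i)).1
  refine ⟨Module.Finite.equiv (Ideal.quotientEquivDirectSum K b h).symm, ?_⟩
  refine (associated_norm_prod_smith b hs).trans ?_
  rw [Ideal.finrank_quotient_eq_sum K h b, ← Finset.prod_pow_eq_pow_sum]
  exact Associated.prod _ _ _ fun i _ =>
    (finite_quotient_span_singleton (Ideal.smithCoeffs_ne_zero b _ h i)).2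

end PowerSeries

end

/-! ### Norms as products of differences of roots. -/

section

open Polynomial

theorem Matrix.det_aeval_eq_prod {L n : Type*} [Field L] [Fintype n] [DecidableEq n]
    (M : Matrix n n L) {G : L[X]} (hm : G.Monic) (hG : G.Splits) :
    (aeval M G).det =
      (G.roots.map fun β => (-1) ^ Fintype.card n * M.charpoly.eval β).prod := by
  conv_lhs => rw [hG.eq_prod_roots_of_monic hm]
  induction G.roots using Multiset.induction_on with
  | empty => simp
  | cons β s ih =>
    rw [Multiset.map_cons, Multiset.prod_cons, map_mul, Matrix.det_mul, ih, Multiset.map_cons,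
      Multiset.prod_cons, Matrix.eval_charpoly, ← Matrix.det_neg, neg_sub]
    congr 2
    simp [Matrix.algebraMap_eq_diagonal]

theorem AdjoinRoot.minpoly_root_of_monic {A : Type*} [CommRing A] [Nontrivial A] {F : A[X]}
    (hF : F.Monic) : minpoly A (AdjoinRoot.root F) = F := by
  refine (minpoly.unique' A _ hF (by rw [AdjoinRoot.aeval_eq, AdjoinRoot.mk_self]) fun q hq => ?_).symm
  rw [AdjoinRoot.aeval_eq, Ne, AdjoinRoot.mk_eq_zero]
  by_cases h : q = 0
  · exact Or.inl h
  · exact Or.inr (hF.not_dvd_of_degree_lt h hq)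

/-- The norm is det G(M), with M the matrix of multiplication by the root. Its characteristic
polynomial is F, and the sign in (-1)^n F(β) turns each factor β - α into α - β. -/
theorem AdjoinRoot.map_norm_mk {A L : Type*} [CommRing A] [Nontrivial A] [Field L] (φ : A →+* L)
    {F G : A[X]} (hF : F.Monic) (hG : G.Monic)
    (sF : (F.map φ).Splits) (sG : (G.map φ).Splits) :
    φ (Algebra.norm A (AdjoinRoot.mk F G)) =
      ((G.map φ).roots.map fun β => ((F.map φ).roots.map fun α => α - β).prod).prod := by
  set pb := AdjoinRoot.powerBasis' hF
  have hmk : AdjoinRoot.mk F G = aeval pb.gen G := by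
    rw [show pb.gen = AdjoinRoot.root F from rfl, AdjoinRoot.aeval_eq]
  have hch : (Algebra.leftMulMatrix pb.basis pb.gen).charpoly = F := by
    rw [charpoly_leftMulMatrix]
    exact AdjoinRoot.minpoly_root_of_monic hF
  have hdim : Fintype.card (Fin pb.dim) = Multiset.card (F.map φ).roots := by
    rw [Fintype.card_fin, splits_iff_card_roots.1 sF, hF.natDegree_map]
    rfl
  have hmap : φ.mapMatrix (aeval (Algebra.leftMulMatrix pb.basis pb.gen) G) =
      aeval (φ.mapMatrix (Algebra.leftMulMatrix pb.basis pb.gen)) (G.map φ) := by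
    rw [aeval_def, aeval_def, hom_eval₂, eval₂_map]
    congr 1
    ext a i j
    by_cases h : i = j <;> simp [Matrix.algebraMap_eq_diagonal, h]
  rw [Algebra.norm_eq_matrix_det pb.basis, hmk, ← aeval_algHom_apply, RingHom.map_det, hmap,
    Matrix.det_aeval_eq_prod _ (hG.map φ) sG, RingHom.mapMatrix_apply, Matrix.charpoly_map, hch]
  congr 1
  refine Multiset.map_congr rfl fun β _ => ?_
  conv_lhs => rw [sF.eq_prod_roots_of_monic (hF.map φ)]
  rw [eval_multiset_prod, Multiset.map_map, hdim, ← Multiset.card_map (fun α => X - C α),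
    ← Multiset.prod_replicate, ← Multiset.map_const', Multiset.map_map, ← Multiset.prod_map_mul]
  congr 1
  exact Multiset.map_congr rfl fun α _ => by simp

end

/-! ### Orbit products of an ultrametric distance. -/

section

/-- A group acting by isometries of an ultrametric distance. -/
theorem prod_dist_smul_le_max {Γ X : Type*} [Group Γ] [Fintype Γ] [MulAction Γ X] (δ : X → X → ℝ)
    (h0 : ∀ a b, 0 ≤ δ a b) (hc : ∀ a b, δ a b = δ b a)
    (hu : ∀ a b c, δ a c ≤ max (δ a b) (δ b c)) (hs : ∀ (σ : Γ) a b, δ (σ • a) (σ • b) = δ a b)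
    (a b c : X) :
    ∏ σ : Γ, δ a (σ • c) ≤ max (∏ σ : Γ, δ a (σ • b)) (∏ σ : Γ, δ b (σ • c)) := by
  -- the product only depends on the orbits
  have hr : ∀ (τ : Γ) x y, ∏ σ : Γ, δ x (σ • τ • y) = ∏ σ : Γ, δ x (σ • y) := fun τ x y =>
    Fintype.prod_equiv (Equiv.mulRight τ) _ _ fun σ => by simp [mul_smul]
  have hl : ∀ (τ : Γ) x y, ∏ σ : Γ, δ (τ • x) (σ • y) = ∏ σ : Γ, δ x (σ • y) := fun τ x y =>
    Fintype.prod_equiv (Equiv.mulLeft τ⁻¹) _ _ fun σ => by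
      rw [← hs τ⁻¹]; simp [mul_smul]
  obtain ⟨τ, hτ⟩ := Finite.exists_min fun σ : Γ => δ (σ • a) b
  -- Replace a and c by the points x and z of their orbits nearest to b. Minimality makes δ(x, σb)
  -- and δ(z, σb) explicit maxima, so the final comparison can be made factor by factor.
  obtain ⟨ρ, hρ⟩ := Finite.exists_min fun σ : Γ => δ (σ • c) b
  rw [← hl τ a c, ← hl τ a b, ← hr ρ (τ • a) c, ← hr ρ b c]
  set x := τ • a
  set z := ρ • c
  have hx : ∀ σ : Γ, δ x (σ • b) = max (δ x b) (δ b (σ • b)) := by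
    intro σ
    have h1 : δ x b ≤ δ x (σ • b) := by
      rw [← hs σ⁻¹ x (σ • b), inv_smul_smul, show σ⁻¹ • x = (σ⁻¹ * τ) • a by simp [x, mul_smul]]
      exact hτ _
    refine le_antisymm (hu _ _ _) (max_le h1 ?_)
    refine (hu b x _).trans (max_le ?_ le_rfl)
    rwa [hc b x]
  have hz : ∀ σ : Γ, δ z (σ • b) = max (δ z b) (δ b (σ • b)) := by
    intro σ
    have h1 : δ z b ≤ δ z (σ • b) := by
      rw [← hs σ⁻¹ z (σ • b), inv_smul_smul, show σ⁻¹ • z = (σ⁻¹ * ρ) • c by simp [z, mul_smul]]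
      exact hρ _
    refine le_antisymm (hu _ _ _) (max_le h1 ?_)
    refine (hu b z _).trans (max_le ?_ le_rfl)
    rwa [hc b z]
  have hbz : ∏ σ : Γ, δ b (σ • z) = ∏ σ : Γ, δ z (σ • b) :=
    Fintype.prod_equiv (Equiv.inv Γ) _ _ fun σ => by
      rw [← hs σ⁻¹, inv_smul_smul, hc]; simp
  rw [hbz, le_max_iff]
  have key : ∀ σ : Γ, δ x (σ • z) ≤ max (max (δ x b) (δ z b)) (δ b (σ • b)) := by
    intro σ
    refine (hu x b _).trans (max_le ((le_max_left _ _).trans (le_max_left _ _)) ?_)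
    refine (hu b (σ • b) _).trans (max_le (le_max_right _ _) ?_)
    rw [hs, hc]
    exact (le_max_right _ _).trans (le_max_left _ _)
  rcases le_total (δ z b) (δ x b) with h | h
  · left
    refine Finset.prod_le_prod (fun _ _ => h0 _ _) fun σ _ => ?_
    rw [hx σ]; simpa [h] using key σ
  · right
    refine Finset.prod_le_prod (fun _ _ => h0 _ _) fun σ _ => ?_
    rw [hz σ]; simpa [h] using key σ

end

/-! ### Absolute values over K((x)) and averaging over automorphisms. -/

section

open Polynomial
open scoped LaurentSeries PowerSeries

theorem LaurentSeries.valuation_coe_isUnit {K : Type*} [Field K] {u : K⟦X⟧} (hu : IsUnit u) :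
    Valued.v (algebraMap K⟦X⟧ K⸨X⸩ u) = 1 := by
  have hle : ∀ w : K⟦X⟧, Valued.v (algebraMap K⟦X⟧ K⸨X⸩ w) ≤ 1 := fun w =>
    (LaurentSeries.val_le_one_iff_eq_coe K _).2 ⟨w, rfl⟩
  obtain ⟨w, hw⟩ := hu.exists_right_inv
  refine le_antisymm (hle u) ?_
  have h1 : Valued.v (algebraMap K⟦X⟧ K⸨X⸩ u) * Valued.v (algebraMap K⟦X⟧ K⸨X⸩ w) = 1 := by
    rw [← map_mul, ← map_mul, hw, map_one, map_one]
  rw [← h1]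
  exact mul_le_of_le_one_right' (hle w)

/-- The valuation of `K((x))` extends to algebraic extensions as an absolute value that is
ultrametric and invariant under automorphisms. -/
theorem LaurentSeries.exists_absoluteValue (K L : Type*) [Field K] [Field L] [Algebra K⸨X⸩ L]
    [Algebra.IsAlgebraic K⸨X⸩ L] :
    ∃ (ν : L →*₀ ℝ) (q : ℝ), (∀ x, 0 ≤ ν x) ∧ (∀ x, ν (-x) = ν x) ∧
      (∀ x y, ν (x + y) ≤ max (ν x) (ν y)) ∧ (∀ (σ : L ≃ₐ[K⸨X⸩] L) x, ν (σ x) = ν x) ∧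
      0 < q ∧ q < 1 ∧ ∀ (a : K⟦X⟧) (n : ℕ), Associated a (PowerSeries.X ^ n) →
        ν (algebraMap K⸨X⸩ L (algebraMap K⟦X⟧ K⸨X⸩ a)) = q ^ n := by
  have hX : (Valued.v (algebraMap K⟦X⟧ K⸨X⸩ PowerSeries.X) : WithZero (Multiplicative ℤ)) =
      WithZero.exp (-1) := by
    simpa using LaurentSeries.valuation_X_pow K 1
  -- The base 2 is arbitrary: only 0 < ‖X‖ < 1 matters.
  let _ : Valuation.RankOne (Valued.v : Valuation K⸨X⸩ (WithZero (Multiplicative ℤ))) :=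
    { hom' := (WithZeroMulInt.toNNReal (e := 2) two_ne_zero).comp
        MonoidWithZeroHom.ValueGroup₀.embedding
      strictMono' := (WithZeroMulInt.toNNReal_strictMono one_lt_two).comp
        MonoidWithZeroHom.ValueGroup₀.embedding_strictMono
      exists_val_nontrivial := ⟨algebraMap K⟦X⟧ K⸨X⸩ PowerSeries.X, by
        rw [hX]; exact ⟨WithZero.exp_ne_zero, by decide⟩⟩ }
  let _ : NontriviallyNormedField K⸨X⸩ := Valued.toNontriviallyNormedField K⸨X⸩ _
  have _ : IsUltrametricDist K⸨X⸩ := inferInstance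
  have _ : CompleteSpace K⸨X⸩ := LaurentSeries.instLaurentSeriesComplete
  -- Completeness makes the spectral norm multiplicative. It depends only on minimal polynomials,
  -- whence its invariance under automorphisms.
  let ν := spectralMulAlgNorm K⸨X⸩ L
  refine ⟨⟨⟨ν, map_zero ν⟩, map_one ν, map_mul ν⟩, ‖algebraMap K⟦X⟧ K⸨X⸩ PowerSeries.X‖,
    fun x => apply_nonneg ν x, fun x => map_neg_eq_map ν x, isNonarchimedean_spectralNorm,
    fun σ x => (spectralNorm_eq_of_equiv σ x).symm, ?_, ?_, ?_⟩
  · simp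
  · rw [Valued.toNormedField.norm_lt_one_iff, hX]
    decide
  · rintro a n ⟨u, hu⟩
    change spectralNorm K⸨X⸩ L _ = _
    rw [spectralNorm_extends, ← norm_pow, ← map_pow, ← hu, map_mul, norm_mul]
    have h1 : ‖algebraMap K⟦X⟧ K⸨X⸩ u‖ = 1 := by
      have := LaurentSeries.valuation_coe_isUnit u.isUnit
      exact le_antisymm (Valued.toNormedField.norm_le_one_iff.2 this.le)
        (Valued.toNormedField.one_le_norm_iff.2 this.ge)
    rw [h1, mul_one]

/-- Each automorphism preserves the multiset of roots, and the automorphisms act transitively on the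
roots. Exchanging the two products therefore suffices, even if p is inseparable and its roots are
repeated. -/
theorem Polynomial.prod_roots_pow_card_aut {M L N : Type*} [Field M] [Field L] [Algebra M L]
    [FiniteDimensional M L] [Normal M L] [CommMonoid N] {p : M[X]} (hp : Irreducible p)
    (hs : (p.map (algebraMap M L)).Splits) {β : L} (hβ : β ∈ (p.map (algebraMap M L)).roots)
    (u : L → N) :
    ((p.map (algebraMap M L)).roots.map u).prod ^ Fintype.card (L ≃ₐ[M] L) =
      (∏ σ : L ≃ₐ[M] L, u (σ β)) ^ Multiset.card (p.map (algebraMap M L)).roots := by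
  set R := (p.map (algebraMap M L)).roots with hR
  have hroot : ∀ x ∈ R, ∃ τ : L ≃ₐ[M] L, τ β = x := by
    intro x hx
    have h0 : ∀ y ∈ R, aeval y p = 0 := fun y hy => by
      rw [aeval_def, ← eval_map]; exact (mem_roots'.1 hy).2
    refine minpoly.exists_algEquiv_of_root' (Algebra.IsAlgebraic.isAlgebraic _) ?_
    rw [← minpoly.eq_of_irreducible hp (h0 β hβ), map_mul, h0 x hx, zero_mul]
  have hperm : ∀ σ : L ≃ₐ[M] L, R.map σ = R := by
    intro σ
    rw [hR]
    refine (hs.roots_map (σ : L →+* L)).symm.trans ?_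
    rw [Polynomial.map_map]
    congr 2
    exact σ.toAlgHom.comp_algebraMap
  calc (R.map u).prod ^ Fintype.card (L ≃ₐ[M] L)
      = ∏ σ : L ≃ₐ[M] L, (R.map fun x => u (σ x)).prod := by
        rw [Fintype.card, ← Finset.prod_const]
        refine Finset.prod_congr rfl fun σ _ => ?_
        conv_lhs => rw [← hperm σ, Multiset.map_map]
        rfl
    _ = (R.map fun x => ∏ σ : L ≃ₐ[M] L, u (σ x)).prod :=
        (Multiset.prod_map_prod).symm
    _ = (R.map fun _ => ∏ σ : L ≃ₐ[M] L, u (σ β)).prod := by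
        congr 1
        refine Multiset.map_congr rfl fun x hx => ?_
        obtain ⟨τ, rfl⟩ := hroot x hx
        exact Fintype.prod_equiv (Equiv.mulRight τ) _ _ fun σ => by simp
    _ = _ := by rw [Multiset.map_const', Multiset.prod_replicate]

end

/-! ### The triangle inequality for irreducible polynomials over K⟦X⟧. -/

section

open Polynomial
open scoped LaurentSeries PowerSeries

/-- The dimension of `K⟦X⟧[Y] / (F, G)`. -/
noncomputable def finrankQuotient {K : Type*} [Field K] (F G : K⟦X⟧[X]) : ℕ :=
  Module.finrank K (AdjoinRoot F ⧸ Ideal.span {AdjoinRoot.mk F G})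

theorem not_dvd_of_monic_irreducible {A : Type*} [CommRing A] [IsDomain A] {F G : A[X]}
    (hF : F.Monic) (hG : G.Monic) (iF : Irreducible F) (iG : Irreducible G) (hne : F ≠ G) :
    ¬ F ∣ G := fun h =>
  hne (eq_of_monic_of_associated hF hG (iF.associated_of_dvd iG h))

theorem finite_quotient_and_associated {K : Type*} [Field K] {F G : K⟦X⟧[X]} (hF : F.Monic)
    (iF : Irreducible F) (h : ¬ F ∣ G) :
    Module.Finite K (AdjoinRoot F ⧸ Ideal.span {AdjoinRoot.mk F G}) ∧
      Associated (Algebra.norm K⟦X⟧ (AdjoinRoot.mk F G))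
        (PowerSeries.X ^ finrankQuotient F G) := by
  have : IsDomain (AdjoinRoot F) := AdjoinRoot.isDomain_of_prime iF.prime
  exact PowerSeries.associated_norm_X_pow_finrank (AdjoinRoot.powerBasis' hF).basis
    (by rwa [Ne, AdjoinRoot.mk_eq_zero])

/-- The strong triangle inequality for irreducible monic polynomials over `K⟦X⟧`. -/
theorem finrankQuotient_triangle {K : Type*} [Field K] {F G H : K⟦X⟧[X]}
    (hF : F.Monic) (hG : G.Monic) (hH : H.Monic)
    (iF : Irreducible F) (iG : Irreducible G) (iH : Irreducible H)
    (hFG : F ≠ G) (hGH : G ≠ H) (hFH : F ≠ H) :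
    finrankQuotient F G * H.natDegree ≤ finrankQuotient F H * G.natDegree ∨
      finrankQuotient G H * F.natDegree ≤ finrankQuotient F H * G.natDegree := by
  set P := F * G * H
  let L := (P.map (algebraMap K⟦X⟧ K⸨X⸩)).SplittingField
  let φ : K⟦X⟧ →+* L := (algebraMap K⸨X⸩ L).comp (algebraMap K⟦X⟧ K⸨X⸩)
  obtain ⟨ν, q, h0, hneg, hadd, hσ, hq0, hq1, hq⟩ := LaurentSeries.exists_absoluteValue K L
  have hP : (P.map φ).Splits := by
    rw [← Polynomial.map_map]; exact SplittingField.splits _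
  have hPm : P.map φ ≠ 0 := (((hF.mul hG).mul hH).map φ).ne_zero
  have hsplit : ∀ Q : K⟦X⟧[X], Q ∣ P → (Q.map φ).Splits := fun Q hQ =>
    hP.of_dvd hPm (Polynomial.map_dvd φ hQ)
  have sF := hsplit F ⟨G * H, by ring⟩
  have sG := hsplit G ⟨F * H, by ring⟩
  have sH := hsplit H ⟨F * G, by ring⟩
  have hirr : ∀ {Q : K⟦X⟧[X]}, Q.Monic → Irreducible Q →
      Irreducible (Q.map (algebraMap K⟦X⟧ K⸨X⸩)) := fun hQ iQ =>
    hQ.irreducible_iff_irreducible_map_fraction_map.1 iQ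
  have hexists : ∀ {Q : K⟦X⟧[X]}, Q.Monic → Irreducible Q → (Q.map φ).Splits →
      ∃ α, α ∈ (Q.map φ).roots := by
    intro Q hQ iQ sQ
    obtain ⟨α, hα⟩ := sQ.exists_eval_eq_zero (by
      rw [hQ.degree_map]
      exact fun h => iQ.ne_one (eq_one_of_monic_natDegree_zero hQ (natDegree_eq_of_degree_eq_some h)))
    exact ⟨α, (mem_roots (hQ.map φ).ne_zero).2 hα⟩
  have hdeg : ∀ {Q : K⟦X⟧[X]}, Q.Monic → (Q.map φ).Splits →
      Multiset.card (Q.map φ).roots = Q.natDegree := fun hQ sQ => by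
    rw [splits_iff_card_roots.1 sQ, Monic.natDegree_map hQ]
  let Γ := L ≃ₐ[K⸨X⸩] L
  let D : L → L → ℝ := fun a b => ∏ σ : Γ, ν (a - σ b)
  have hD0 : ∀ a b, 0 ≤ D a b := fun a b => Finset.prod_nonneg fun _ _ => h0 _
  have hsub : ∀ a b, ν (a - b) = ν (b - a) := fun a b => by rw [← hneg, neg_sub]
  -- The power |Γ| allows averaging over the roots of F. The resulting orbit product is the same at
  -- all roots of G (`h4`), so averaging over those costs no further power (`h5`).
  have key : ∀ {F G : K⟦X⟧[X]}, F.Monic → G.Monic → Irreducible F → Irreducible G → F ≠ G →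
      (F.map φ).Splits → (G.map φ).Splits → ∀ {α β}, α ∈ (F.map φ).roots → β ∈ (G.map φ).roots →
      (q ^ finrankQuotient F G) ^ Fintype.card Γ = D α β ^ (F.natDegree * G.natDegree) := by
    intro F G hF hG iF iG hne sF sG α β hα hβ
    rw [← hq _ _ (finite_quotient_and_associated hF iF
      (not_dvd_of_monic_irreducible hF hG iF iG hne)).2]
    have h1 := AdjoinRoot.map_norm_mk φ hF hG sF sG
    have h2 : ∀ b, ν ((F.map φ).roots.map fun α => α - b).prod ^ Fintype.card Γ =
        (∏ σ : Γ, ν (σ α - b)) ^ F.natDegree := by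
      intro b
      have := Polynomial.prod_roots_pow_card_aut (hirr hF iF) (L := L) (β := α)
        (by rwa [Polynomial.map_map]) (by rwa [Polynomial.map_map]) fun v => ν (v - b)
      rw [Polynomial.map_map] at this
      rw [map_multiset_prod, Multiset.map_map]
      exact this.trans (congrArg _ (hdeg hF sF))
    have h3 := Polynomial.prod_roots_pow_card_aut (hirr hG iG) (L := L) (β := β)
        (by rwa [Polynomial.map_map]) (by rwa [Polynomial.map_map])
        fun b => ∏ σ : Γ, ν (σ α - b)
    have h4 : ∀ τ : Γ, ∏ σ : Γ, ν (σ α - τ β) = D α β := fun τ =>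
      Fintype.prod_equiv ((Equiv.inv Γ).trans (Equiv.mulRight τ)) _ _ fun σ => by
        rw [← hσ σ⁻¹, map_sub, show σ⁻¹ (σ α) = α from AlgEquiv.symm_apply_apply σ α]
        rfl
    have h5 : ((G.map φ).roots.map fun b => ∏ σ : Γ, ν (σ α - b)).prod =
        D α β ^ G.natDegree := by
      rw [Polynomial.map_map] at h3
      refine (pow_left_inj₀ ?_ ?_ (Fintype.card_ne_zero (α := Γ))).1 (h3.trans ?_)
      · exact Multiset.prod_nonneg fun x hx => by
          obtain ⟨b, -, rfl⟩ := Multiset.mem_map.1 hx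
          exact Finset.prod_nonneg fun _ _ => h0 _
      · exact pow_nonneg (hD0 _ _) _
      · change (∏ τ : Γ, ∏ σ : Γ, ν (σ α - τ β)) ^ _ = _
        rw [Finset.prod_congr rfl fun τ _ => h4 τ, Finset.prod_const, Finset.card_univ,
          pow_right_comm]
        exact congrArg (fun n => (D α β ^ n) ^ Fintype.card Γ) (hdeg hG sG)
    change ν (φ _) ^ _ = _
    rw [h1, map_multiset_prod, Multiset.map_map, ← Multiset.prod_map_pow]
    simp only [Function.comp_apply, h2]
    rw [Multiset.prod_map_pow, h5, ← pow_mul, mul_comm]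
  obtain ⟨α, hα⟩ := hexists hF iF sF
  obtain ⟨β, hβ⟩ := hexists hG iG sG
  obtain ⟨γ, hγ⟩ := hexists hH iH sH
  have kFG := key hF hG iF iG hFG sF sG hα hβ
  have kGH := key hG hH iG iH hGH sG sH hβ hγ
  have kFH := key hF hH iF iH hFH sF sH hα hγ
  have hcard : 0 < Fintype.card Γ := Fintype.card_pos
  have hle : D α γ ≤ max (D α β) (D β γ) :=
    prod_dist_smul_le_max (Γ := Γ) (fun a b => ν (a - b)) (fun _ _ => h0 _) hsub
      (fun a b c => by simpa using hadd (a - b) (b - c))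
      (fun σ a b => by have := hσ σ (a - b); rwa [map_sub σ] at this) α β γ
  -- Since q < 1, comparing powers reverses the inequality between exponents.
  have hexp : ∀ {m n : ℕ}, (q ^ Fintype.card Γ) ^ m ≤ (q ^ Fintype.card Γ) ^ n → n ≤ m :=
    fun h => (pow_le_pow_iff_right_of_lt_one₀ (pow_pos hq0 _) (pow_lt_one₀ hq0.le hq1 hcard.ne')).1 h
  refine (le_max_iff.1 hle).imp (fun h => hexp ?_) fun h => hexp ?_
  · calc (q ^ Fintype.card Γ) ^ (finrankQuotient F H * G.natDegree)
        = ((q ^ finrankQuotient F H) ^ Fintype.card Γ) ^ G.natDegree := by ring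
      _ = (D α γ) ^ (F.natDegree * H.natDegree * G.natDegree) := by rw [kFH, ← pow_mul]
      _ ≤ (D α β) ^ (F.natDegree * H.natDegree * G.natDegree) := pow_le_pow_left₀ (hD0 _ _) h _
      _ = ((q ^ finrankQuotient F G) ^ Fintype.card Γ) ^ H.natDegree := by rw [kFG, ← pow_mul]; ring
      _ = _ := by ring
  · calc (q ^ Fintype.card Γ) ^ (finrankQuotient F H * G.natDegree)
        = ((q ^ finrankQuotient F H) ^ Fintype.card Γ) ^ G.natDegree := by ring
      _ = (D α γ) ^ (F.natDegree * H.natDegree * G.natDegree) := by rw [kFH, ← pow_mul]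
      _ ≤ (D β γ) ^ (F.natDegree * H.natDegree * G.natDegree) := pow_le_pow_left₀ (hD0 _ _) h _
      _ = ((q ^ finrankQuotient G H) ^ Fintype.card Γ) ^ F.natDegree := by rw [kGH, ← pow_mul]; ring
      _ = _ := by ring

end

/-! ### Weierstrass preparation and quotients. -/

section

open Polynomial
open scoped PowerSeries

theorem Associated.span_singleton_eq {R : Type*} [CommRing R] {a b : R} (h : Associated a b) :
    Ideal.span {a} = Ideal.span {b} :=
  le_antisymm (Ideal.span_singleton_le_span_singleton.2 h.symm.dvd)
    (Ideal.span_singleton_le_span_singleton.2 h.dvd)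

/-- A monic factor of F reduces to a power of Y, since F does. If it is a unit as a series, its
constant term is a unit, so that power is Y^0 and the factor has degree 0. -/
theorem Polynomial.IsDistinguishedAt.irreducible {A : Type*} [CommRing A] [IsDomain A]
    [IsLocalRing A] {F : A[X]} (hF : F.IsDistinguishedAt (IsLocalRing.maximalIdeal A))
    (h : Irreducible (F : A⟦X⟧)) : Irreducible F := by
  have key : ∀ f g : A[X], f.Monic → f * g = F → IsUnit (f : A⟦X⟧) → f.natDegree = 0 := by
    intro f g hf hfg hu
    let ρ := Ideal.Quotient.mk (IsLocalRing.maximalIdeal A)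
    let _ : Field (A ⧸ IsLocalRing.maximalIdeal A) := Ideal.Quotient.field _
    have hdvd : f.map ρ ∣ X ^ F.natDegree := by
      rw [← hF.map_eq_X_pow, ← hfg, Polynomial.map_mul]
      exact dvd_mul_right _ _
    obtain ⟨k, -, hk⟩ := (dvd_prime_pow prime_X _).1 hdvd
    have hk' := eq_of_monic_of_associated (hf.map ρ) (monic_X_pow k) hk
    have h0 : IsUnit (ρ (f.coeff 0)) := by
      have := PowerSeries.isUnit_iff_constantCoeff.1 hu
      rw [Polynomial.constantCoeff_coe] at this
      exact this.map ρ
    rw [← coeff_map, hk', coeff_X_pow] at h0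
    rw [← hf.natDegree_map ρ, hk', natDegree_X_pow]
    by_contra hne
    rw [if_neg (Ne.symm hne)] at h0
    exact not_isUnit_zero h0
  refine (hF.monic.irreducible_iff_natDegree).2 ⟨?_, fun f g hf hg hfg => ?_⟩
  · rintro rfl
    exact h.not_isUnit (by simp)
  · rcases h.isUnit_or_isUnit (a := (f : A⟦X⟧)) (b := (g : A⟦X⟧))
      (by rw [← Polynomial.coe_mul, hfg]) with hu | hu
    · exact Or.inl (key f g hf hfg hu)
    · exact Or.inr (key g f hg (by rw [mul_comm, hfg]) hu)

namespace PowerSeries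

variable {K : Type*} [Field K]

instance isAdicComplete_maximalIdeal :
    IsAdicComplete (IsLocalRing.maximalIdeal K⟦X⟧) K⟦X⟧ := by
  rw [maximalIdeal_eq_span_X]
  infer_instance

/-- Weierstrass preparation for `K⟦X⟧⟦Y⟧`. -/
theorem exists_isWeierstrassFactorization_of_coeff {g : K⟦X⟧⟦X⟧} {n : ℕ}
    (hlt : ∀ i < n, constantCoeff (coeff i g) = 0) (hn : constantCoeff (coeff n g) ≠ 0) :
    ∃ (F : K⟦X⟧[X]) (u : K⟦X⟧⟦X⟧), g.IsWeierstrassFactorization F u ∧ F.natDegree = n := by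
  have hres : ∀ a : K⟦X⟧, IsLocalRing.residue K⟦X⟧ a = 0 ↔ constantCoeff a = 0 := by
    intro a
    rw [IsLocalRing.residue_eq_zero_iff, maximalIdeal_eq_span_X, Ideal.mem_span_singleton,
      X_dvd_iff]
  have hord : (g.map (IsLocalRing.residue K⟦X⟧)).order = n := by
    refine order_eq_nat.2 ⟨?_, fun i hi => ?_⟩
    · rwa [coeff_map, Ne, hres]
    · rw [coeff_map, hres, hlt i hi]
  have h0 : g.map (IsLocalRing.residue K⟦X⟧) ≠ 0 := by
    rintro h
    simp [h] at hord
  obtain ⟨F, u, h⟩ := exists_isWeierstrassFactorization h0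
  exact ⟨F, u, h, by rw [h.natDegree_eq_toNat_order_map, hord, ENat.toNat_natCast]⟩

theorem IsWeierstrassFactorizationAt.associated {A : Type*} [CommRing A] {g h : A⟦X⟧} {f : A[X]}
    {I : Ideal A} (H : g.IsWeierstrassFactorizationAt f h I) : Associated (f : A⟦X⟧) g := by
  obtain ⟨u, hu⟩ := H.isUnit
  exact ⟨u, by rw [H.eq_mul, hu]⟩

/-- The quotient by two series is the quotient by their Weierstrass polynomials. -/
noncomputable def IsWeierstrassFactorization.quotientSupEquiv {A : Type*} [CommRing A]
    [IsLocalRing A] [IsAdicComplete (IsLocalRing.maximalIdeal A) A] [Algebra K A]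
    {g₁ u₁ g₂ u₂ : A⟦X⟧} {F G : A[X]} (h₁ : g₁.IsWeierstrassFactorization F u₁)
    (h₂ : g₂.IsWeierstrassFactorization G u₂) :
    (A⟦X⟧ ⧸ (Ideal.span {g₁} ⊔ Ideal.span {g₂})) ≃ₗ[K]
      (AdjoinRoot F ⧸ Ideal.span {AdjoinRoot.mk F G}) :=
  let e : AdjoinRoot F ≃ₐ[A] A⟦X⟧ ⧸ Ideal.span {g₁} := h₁.algEquivQuotient
  ((DoubleQuot.quotQuotEquivQuotSupₐ K (Ideal.span {g₁}) (Ideal.span {g₂})).symm.trans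
    (Ideal.quotientEquivAlg (Ideal.span {AdjoinRoot.mk F G}) _ (e.restrictScalars K) (by
      rw [Ideal.map_span, Ideal.map_span, Set.image_singleton, Set.image_singleton]
      exact (h₂.associated.symm.map (Ideal.Quotient.mk (Ideal.span {g₁}))).span_singleton_eq)).symm
    ).toLinearEquiv

theorem not_finite : ¬ Module.Finite K K⟦X⟧ := fun _ =>
  IsDiscreteValuationRing.not_isField K⟦X⟧
    (isField_of_isIntegral_of_isField' (R := K) (Field.toIsField K))

end PowerSeries

theorem AdjoinRoot.not_finite_of_irreducible {K : Type*} [Field K] {F : K⟦X⟧[X]} (hF : F.Monic)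
    (h : Irreducible F) : ¬ Module.Finite K (AdjoinRoot F) := by
  intro hfin
  have hinj : Function.Injective (AdjoinRoot.of F) :=
    AdjoinRoot.of.injective_of_degree_ne_zero fun h0 =>
      h.ne_one (eq_one_of_monic_natDegree_zero hF (natDegree_eq_of_degree_eq_some h0))
  exact PowerSeries.not_finite (Module.Finite.of_injective
    ((Algebra.linearMap K⟦X⟧ (AdjoinRoot F)).restrictScalars K) hinj)

end

/-! ### General shears and restriction to x = 0. -/

section

open Polynomial
open scoped PowerSeries

namespace MvPowerSeries

variable {K : Type*} [Field K]

/-- The values `y ↦ y`, `x ↦ x + c y` of the variables under a shear. -/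
noncomputable def shearVars (c : K) : Fin 2 → MvPowerSeries (Fin 2) K :=
  ![X 0, X 1 + C c * X 0]

theorem hasSubst_shearVars (c : K) : HasSubst (shearVars c) :=
  hasSubst_of_constantCoeff_zero fun i => by fin_cases i <;> simp [shearVars]

theorem shearVars_zero (c : K) : shearVars c 0 = X 0 := rfl

theorem shearVars_one (c : K) : shearVars c 1 = X 1 + C c * X 0 := rfl

theorem substAlgHom_shearVars {c d : K} (h : c + d = 0) (f : MvPowerSeries (Fin 2) K) :
    substAlgHom (R := K) (hasSubst_shearVars d) (substAlgHom (R := K) (hasSubst_shearVars c) f) =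
      f := by
  rw [substAlgHom_comp_substAlgHom_apply, substAlgHom_apply]
  have : (fun s => substAlgHom (R := K) (hasSubst_shearVars d) (shearVars c s)) =
      (X : Fin 2 → MvPowerSeries (Fin 2) K) := by
    have h0 := substAlgHom_X (R := K) (hasSubst_shearVars d) 0
    have h1 := substAlgHom_X (R := K) (hasSubst_shearVars d) 1
    have hC : substAlgHom (R := K) (hasSubst_shearVars d) (C c) = C c :=
      AlgHom.commutes (substAlgHom (R := K) (hasSubst_shearVars d)) c
    funext i
    obtain rfl | rfl : i = 0 ∨ i = 1 := by omega
    · rw [shearVars_zero, h0, shearVars_zero]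
    · rw [shearVars_one, map_add, map_mul, hC, h0, h1, shearVars_one, shearVars_zero, add_assoc,
        ← add_mul, ← map_add, add_comm d c, h, map_zero, zero_mul, add_zero]
  rw [this, subst_self, id]

/-- The shear `y ↦ y`, `x ↦ x + c y`. -/
noncomputable def shear (c : K) : MvPowerSeries (Fin 2) K ≃ₐ[K] MvPowerSeries (Fin 2) K :=
  AlgEquiv.ofAlgHom (substAlgHom (hasSubst_shearVars c)) (substAlgHom (hasSubst_shearVars (-c)))
    (AlgHom.ext fun f => substAlgHom_shearVars (neg_add_cancel c) f)
    (AlgHom.ext fun f => substAlgHom_shearVars (add_neg_cancel c) f)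

/-- The exponent `(i, j)` of the monomial `y ^ i * x ^ j`. -/
noncomputable def exponent (p : ℕ × ℕ) : Fin 2 →₀ ℕ :=
  Finsupp.single 0 p.1 + Finsupp.single 1 p.2

@[simp] theorem exponent_zero (p : ℕ × ℕ) : exponent p 0 = p.1 := by simp [exponent]

@[simp] theorem exponent_one (p : ℕ × ℕ) : exponent p 1 = p.2 := by simp [exponent]

theorem exponent_apply (d : Fin 2 →₀ ℕ) : exponent (d 0, d 1) = d := by
  ext i; fin_cases i <;> simp

theorem exponent_injective : Function.Injective exponent := fun p q h =>
  Prod.ext (by simpa using DFunLike.congr_fun h 0) (by simpa using DFunLike.congr_fun h 1)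

theorem degree_exponent (p : ℕ × ℕ) : (exponent p).degree = p.1 + p.2 := by
  simp [exponent]

/-- The variable `0` is singled out. -/
def finTwoEquiv : Fin 2 ≃ Option Unit :=
  (_root_.finSuccEquiv 1).trans (Equiv.optionCongr (Equiv.ofUnique (Fin 1) Unit))

theorem finTwoEquiv_zero : finTwoEquiv 0 = none := rfl

/-- `K[[x, y]]` as the ring of power series in `y` over `K[[x]]`. -/
noncomputable def iterEquiv : MvPowerSeries (Fin 2) K ≃ₐ[K] K⟦X⟧⟦X⟧ :=
  (renameEquiv K finTwoEquiv).trans (optionEquivLeft Unit K)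

/-- The restriction of a series to `x = 0`. -/
noncomputable def restrictAxis : MvPowerSeries (Fin 2) K →+* K⟦X⟧ :=
  (PowerSeries.map PowerSeries.constantCoeff).comp (iterEquiv (K := K)).toRingEquiv.toRingHom

theorem coeff_restrictAxis (f : MvPowerSeries (Fin 2) K) (n : ℕ) :
    PowerSeries.coeff n (restrictAxis f) = coeff (Finsupp.single 0 n) f := by
  have h : Finsupp.optionElim n 0 =
      Finsupp.embDomain finTwoEquiv.toEmbedding (Finsupp.single 0 n) := by
    rw [Finsupp.embDomain_single]
    ext a
    cases a <;> simp [finTwoEquiv_zero]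
  refine Eq.trans ?_ (coeff_embDomain_rename finTwoEquiv.toEmbedding f _)
  rw [← h]
  exact coeff_coeff_optionEquivLeft (rename finTwoEquiv f) n 0

theorem restrictAxis_C (c : K) : restrictAxis (C c) = PowerSeries.C c := by
  ext n
  rw [coeff_restrictAxis, coeff_C, PowerSeries.coeff_C]
  simp

theorem restrictAxis_X_zero : restrictAxis (X 0 : MvPowerSeries (Fin 2) K) = PowerSeries.X := by
  ext n
  rw [coeff_restrictAxis, coeff_X, PowerSeries.coeff_X]
  congr 1
  exact propext (Finsupp.single_injective 0).eq_iff

theorem restrictAxis_X_one : restrictAxis (X 1 : MvPowerSeries (Fin 2) K) = 0 := by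
  ext n
  rw [coeff_restrictAxis, coeff_X, map_zero, if_neg]
  intro h
  simpa using DFunLike.congr_fun h 1

theorem coeff_restrictAxis_shear (c : K) (f : MvPowerSeries (Fin 2) K) (n : ℕ) :
    PowerSeries.coeff n (restrictAxis (shear c f)) =
      ∑ p ∈ Finset.HasAntidiagonal.antidiagonal n, coeff (exponent p) f * c ^ p.2 := by
  have hprod : ∀ d : Fin 2 →₀ ℕ,
      coeff (Finsupp.single 0 n) (d.prod fun s e => shearVars c s ^ e) =
        if n = d 0 + d 1 then c ^ d 1 else 0 := by
    intro d
    rw [← coeff_restrictAxis, Finsupp.prod_fintype _ _ (by simp), Fin.prod_univ_two]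
    simp only [shearVars_zero, shearVars_one, map_mul, map_pow, map_add, restrictAxis_C, restrictAxis_X_zero, restrictAxis_X_one, zero_add]
    rw [mul_pow, mul_left_comm, ← pow_add, ← map_pow, PowerSeries.coeff_C_mul,
      PowerSeries.coeff_X_pow]
    simp
  rw [coeff_restrictAxis]
  change coeff _ (substAlgHom (R := K) (hasSubst_shearVars c) f) = _
  rw [substAlgHom_apply, coeff_subst (hasSubst_shearVars c)]
  simp only [hprod]
  rw [finsum_eq_sum_of_support_subset (s := (Finset.HasAntidiagonal.antidiagonal n).image exponent),
    Finset.sum_image exponent_injective.injOn]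
  · refine Finset.sum_congr rfl fun p hp => ?_
    rw [exponent_zero, exponent_one, if_pos (Finset.HasAntidiagonal.mem_antidiagonal.1 hp).symm, smul_eq_mul]
  · intro d hd
    rw [Finset.coe_image]
    refine ⟨(d 0, d 1), ?_, exponent_apply d⟩
    by_contra h
    refine hd ?_
    have h' : n ≠ d 0 + d 1 := fun h' =>
      h (Finset.mem_coe.2 (Finset.HasAntidiagonal.mem_antidiagonal.2 h'.symm))
    simp [h']

/-- After a general shear, the order of a series is the order of its restriction to `x = 0`. -/
theorem exists_polynomial_shear {f : MvPowerSeries (Fin 2) K} (hf : f ≠ 0) {n : ℕ}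
    (hn : f.order = n) :
    ∃ P : K[X], P ≠ 0 ∧ ∀ c, P.eval c ≠ 0 →
      (∀ i < n, PowerSeries.coeff i (restrictAxis (shear c f)) = 0) ∧
      PowerSeries.coeff n (restrictAxis (shear c f)) ≠ 0 := by
  -- The witness is the initial form of f at y = 1: the shear followed by x = 0 sends y^i x^j to c^j
  -- y^(i+j).
  refine ⟨∑ p ∈ Finset.HasAntidiagonal.antidiagonal n, Polynomial.C (coeff (exponent p) f) * Polynomial.X ^ p.2,
    ?_, fun c hc => ⟨fun i hi => ?_, ?_⟩⟩
  · obtain ⟨d, hd, hdn⟩ := exists_coeff_ne_zero_and_order (ne_zero_iff_order_finite.1 hf)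
    have hd' : d 0 + d 1 = n := by
      rw [hn, ← exponent_apply d, degree_exponent] at hdn
      exact_mod_cast hdn
    intro h
    apply hd
    have := congrArg (fun P => Polynomial.coeff P (d 1)) h
    simp only [Polynomial.finsetSum_coeff, Polynomial.coeff_C_mul, Polynomial.coeff_X_pow,
      Polynomial.coeff_zero] at this
    rw [Finset.sum_eq_single (d 0, d 1)] at this
    · simpa [exponent_apply] using this
    · rintro ⟨i, j⟩ hp hne
      rw [Finset.HasAntidiagonal.mem_antidiagonal] at hp
      have : d 1 ≠ j := by
        rintro rfl
        exact hne (Prod.ext (by simp at hp ⊢; omega) rfl)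
      simp [this]
    · intro h; exact absurd (Finset.HasAntidiagonal.mem_antidiagonal.2 hd') h
  · rw [coeff_restrictAxis_shear]
    refine Finset.sum_eq_zero fun p hp => ?_
    rw [coeff_of_lt_order, zero_mul]
    rw [hn, degree_exponent, Finset.HasAntidiagonal.mem_antidiagonal.1 hp]
    exact_mod_cast hi
  · rw [coeff_restrictAxis_shear]
    simpa [Polynomial.eval_finsetSum] using hc

end MvPowerSeries

end

/-! ### From branches to Weierstrass polynomials. -/

section

open Polynomial
open scoped PowerSeries

namespace AlgebroidCurve

variable {K : Type*} [Field K]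

/-- `F` is a Weierstrass polynomial of `f` after the shear of slope `c`. -/
def IsShearedPolynomial (c : K) (f : Series2 K) (F : K⟦X⟧[X]) : Prop :=
  ∃ u, (MvPowerSeries.iterEquiv (MvPowerSeries.shear c f)).IsWeierstrassFactorization F u

theorem exists_isShearedPolynomial {f : Series2 K} (hf : f ≠ 0) {n : ℕ}
    (hn : MvPowerSeries.order f = n) :
    ∃ P : K[X], P ≠ 0 ∧ ∀ c, P.eval c ≠ 0 →
      ∃ F, IsShearedPolynomial c f F ∧ F.natDegree = n := by
  obtain ⟨P, hP, h⟩ := MvPowerSeries.exists_polynomial_shear hf hn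
  refine ⟨P, hP, fun c hc => ?_⟩
  obtain ⟨F, u, hF, hd⟩ := PowerSeries.exists_isWeierstrassFactorization_of_coeff
    (g := MvPowerSeries.iterEquiv (MvPowerSeries.shear c f)) (h c hc).1 (h c hc).2
  exact ⟨F, ⟨u, hF⟩, hd⟩

namespace IsShearedPolynomial

variable {c : K} {f g : Series2 K} {F G : K⟦X⟧[X]}

theorem monic (h : IsShearedPolynomial c f F) : F.Monic := h.choose_spec.isDistinguishedAt.monic

theorem associated (h : IsShearedPolynomial c f F) :
    Associated (F : K⟦X⟧⟦X⟧) (MvPowerSeries.iterEquiv (MvPowerSeries.shear c f)) :=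
  PowerSeries.IsWeierstrassFactorizationAt.associated h.choose_spec

theorem irreducible (h : IsShearedPolynomial c f F) (hf : Irreducible f) : Irreducible F := by
  refine h.choose_spec.isDistinguishedAt.irreducible (h.associated.irreducible_iff.2 ?_)
  exact (MulEquiv.irreducible_iff
    ((MvPowerSeries.shear c).trans MvPowerSeries.iterEquiv)).2 hf

theorem span_eq (hf : IsShearedPolynomial c f F) (hg : IsShearedPolynomial c g F) :
    Ideal.span {f} = Ideal.span {g} := by
  refine Associated.span_singleton_eq ?_
  simpa using (hf.associated.symm.trans hg.associated).map
    ((MvPowerSeries.shear c).trans MvPowerSeries.iterEquiv).symm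

theorem codim_eq (hf : IsShearedPolynomial c f F) (hg : IsShearedPolynomial c g G) :
    codim (Ideal.span {f} ⊔ Ideal.span {g}) =
      Cardinal.toENat (Module.rank K (AdjoinRoot F ⧸ Ideal.span {AdjoinRoot.mk F G})) := by
  obtain ⟨u, hu⟩ := hf
  obtain ⟨v, hv⟩ := hg
  have e := (Ideal.quotientEquivAlg (Ideal.span {f} ⊔ Ideal.span {g})
    (Ideal.span {MvPowerSeries.iterEquiv (MvPowerSeries.shear c f)} ⊔
      Ideal.span {MvPowerSeries.iterEquiv (MvPowerSeries.shear c g)})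
    ((MvPowerSeries.shear c).trans MvPowerSeries.iterEquiv)
    (by simp [Ideal.map_sup, Ideal.map_span])).toLinearEquiv ≪≫ₗ
    PowerSeries.IsWeierstrassFactorization.quotientSupEquiv (K := K) hu hv
  rw [codim, e.rank_eq]

theorem codim_eq_finrankQuotient (hf : IsShearedPolynomial c f F)
    (hg : IsShearedPolynomial c g G) (iF : Irreducible f) (iG : Irreducible g) (hne : F ≠ G) :
    codim (Ideal.span {f} ⊔ Ideal.span {g}) = finrankQuotient F G := by
  have := (finite_quotient_and_associated hf.monic (hf.irreducible iF)
    (not_dvd_of_monic_irreducible hf.monic hg.monic (hf.irreducible iF)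
      (hg.irreducible iG) hne)).1
  rw [hf.codim_eq hg, ← Module.finrank_eq_rank, finrankQuotient]
  simp

/-- The quotient is `AdjoinRoot F`, which contains the infinite-dimensional K⟦X⟧. -/
theorem codim_self (hf : IsShearedPolynomial c f F) (iF : Irreducible f) :
    codim (Ideal.span {f} ⊔ Ideal.span {f}) = ⊤ := by
  rw [hf.codim_eq hf, Cardinal.toENat_eq_top, ← not_lt, Module.rank_lt_aleph0_iff]
  intro hfin
  refine AdjoinRoot.not_finite_of_irreducible hf.monic (hf.irreducible iF) (K := K) ?_
  have h : Ideal.span {AdjoinRoot.mk F F} = ⊥ := by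
    rw [AdjoinRoot.mk_self, Ideal.span_singleton_eq_bot]
  exact Module.Finite.equiv
    ((Submodule.quotEquivOfEqBot _ h).restrictScalars K)

theorem natDegree_pos (hf : IsShearedPolynomial c f F) (iF : Irreducible f) : 0 < F.natDegree :=
  Nat.pos_of_ne_zero fun h =>
    (hf.irreducible iF).ne_one (eq_one_of_monic_natDegree_zero hf.monic h)

end IsShearedPolynomial

theorem exists_order_eq {f : Series2 K} (hf : f ≠ 0) :
    ∃ n : ℕ, MvPowerSeries.order f = n :=
  ⟨_, (MvPowerSeries.ne_zero_iff_order_finite.1 hf).symm⟩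

theorem orderOfContact_comm (A B : AlgebroidCurve K) :
    orderOfContact A B = orderOfContact B A := by
  rw [orderOfContact, orderOfContact, intersectionNumber, intersectionNumber, sup_comm, mul_comm]

theorem _root_.ENNReal.natCast_div_le_div {a b x y z : ℕ} (hx : x ≠ 0) (hy : y ≠ 0) (hz : z ≠ 0)
    (h : a * z ≤ b * y) :
    (a : ℝ≥0∞) / (x * y) ≤ b / (x * z) := by
  have hpos : ∀ {m n : ℕ}, m ≠ 0 → n ≠ 0 → (m : ℝ≥0∞) * n ≠ 0 := fun hm hn =>
    mul_ne_zero (Nat.cast_ne_zero.2 hm) (Nat.cast_ne_zero.2 hn)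
  have htop : ∀ {m n : ℕ}, (m : ℝ≥0∞) * n ≠ ⊤ := fun {m n} =>
    ENNReal.mul_ne_top (ENNReal.natCast_ne_top m) (ENNReal.natCast_ne_top n)
  rw [ENNReal.div_le_iff (hpos hx hy) htop, ← ENNReal.mul_div_right_comm,
    ENNReal.le_div_iff_mul_le (Or.inl (hpos hx hz)) (Or.inl htop)]
  calc (a : ℝ≥0∞) * (x * z) = x * ((a * z : ℕ) : ℝ≥0∞) := by push_cast; ring
    _ ≤ x * ((b * y : ℕ) : ℝ≥0∞) := by gcongr
    _ = b * (x * y) := by push_cast; ring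

/-- The strong triangle inequality for the order of contact of branches. -/
theorem min_orderOfContact_le [Infinite K] {A B C : AlgebroidCurve K} (hA : A.IsBranch)
    (hB : B.IsBranch) (hC : C.IsBranch) :
    min (orderOfContact A B) (orderOfContact B C) ≤ orderOfContact A C := by
  obtain ⟨f, iF, hf⟩ := hA
  obtain ⟨g, iG, hg⟩ := hB
  obtain ⟨h, iH, hh⟩ := hC
  obtain ⟨l, hl⟩ := exists_order_eq iF.ne_zero
  obtain ⟨m, hm⟩ := exists_order_eq iG.ne_zero
  obtain ⟨n, hn⟩ := exists_order_eq iH.ne_zero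
  obtain ⟨P, hP, hP'⟩ := exists_isShearedPolynomial iF.ne_zero hl
  obtain ⟨Q, hQ, hQ'⟩ := exists_isShearedPolynomial iG.ne_zero hm
  obtain ⟨R, hR, hR'⟩ := exists_isShearedPolynomial iH.ne_zero hn
  -- One slope must suit all three branches; it exists because K is infinite.
  obtain ⟨c, hc⟩ : ∃ c, (P * Q * R).eval c ≠ 0 := by
    by_contra! hall
    exact mul_ne_zero (mul_ne_zero hP hQ) hR (Polynomial.funext fun c => by simpa using hall c)
  rw [eval_mul, eval_mul] at hc
  obtain ⟨F, hF, rfl⟩ := hP' c (left_ne_zero_of_mul (left_ne_zero_of_mul hc))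
  obtain ⟨G, hG, rfl⟩ := hQ' c (right_ne_zero_of_mul (left_ne_zero_of_mul hc))
  obtain ⟨H, hH, rfl⟩ := hR' c (right_ne_zero_of_mul hc)
  have pF := (hF.natDegree_pos iF).ne'
  have pG := (hG.natDegree_pos iG).ne'
  have pH := (hH.natDegree_pos iH).ne'
  by_cases hFG : F = G
  · subst hFG
    rw [AlgebroidCurve.ext (hf.trans ((hF.span_eq hG).trans hg.symm))]
    exact min_le_right _ _
  by_cases hGH : G = H
  · subst hGH
    rw [AlgebroidCurve.ext (hg.trans ((hG.span_eq hH).trans hh.symm))]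
    exact min_le_left _ _
  simp only [orderOfContact, intersectionNumber, A.multiplicity_eq_order f hf,
    B.multiplicity_eq_order g hg, C.multiplicity_eq_order h hh, hl, hm, hn, hf, hg, hh,
    hF.codim_eq_finrankQuotient hG iF iG hFG, hG.codim_eq_finrankQuotient hH iG iH hGH]
  -- Here A = C has infinite contact with itself, which bounds any minimum.
  by_cases hFH : F = H
  · subst hFH
    rw [← hF.span_eq hH, hF.codim_self iF]
    simp [ENNReal.top_div, ENNReal.mul_eq_top]
  rw [hF.codim_eq_finrankQuotient hH iF iH hFH]
  simp only [ENat.toENNReal_coe]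
  rw [min_le_iff]
  refine (finrankQuotient_triangle hF.monic hG.monic hH.monic (hF.irreducible iF)
    (hG.irreducible iG) (hH.irreducible iH) hFG hGH hFH).imp (fun h => ?_) fun h => ?_
  · exact ENNReal.natCast_div_le_div pF pG pH h
  · rw [mul_comm (G.natDegree : ℝ≥0∞), mul_comm (F.natDegree : ℝ≥0∞)]
    exact ENNReal.natCast_div_le_div pH pG pF h

end AlgebroidCurve

end

/-! ### The formula for d_k of a reduced curve. -/

theorem mainTheorem11 {K : Type*} [Field K] [IsAlgClosed K] (k : ℕ) (hk : 1 ≤ k)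
    (C : AlgebroidCurve K) (hC : C.IsReduced)
    (r : ℕ) (hr : 1 < r) (B : Fin r → AlgebroidCurve K)
    (hinj : Function.Injective B) (hB : Set.range B = C.components) :
    C.contactExponent k =
      min (⨅ i : Fin r, (B i).contactExponent k)
        (⨅ i : Fin r, ⨅ j : Fin r, AlgebroidCurve.orderOfContact (B i) (B j)) := by
  have : Infinite K := IsAlgClosed.instInfinite
  have hbr : ∀ i, (B i).IsBranch := fun i =>
    (hB ▸ Set.mem_range_self i : B i ∈ C.components).1
  have hcontact : ∀ W : AlgebroidCurve K, W.IsBranch →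
      C.contact W = ⨅ i, AlgebroidCurve.orderOfContact (B i) W := fun W hW => by
    simp only [AlgebroidCurve.contact, ← hB, hW.components_eq, iInf_range, Set.mem_singleton_iff,
      iInf_iInf_eq_left]
  apply le_antisymm
  · refine iSup₂_le fun W hW => ?_
    rw [hcontact W hW.1]
    refine le_min (le_iInf fun i => ?_) (le_iInf fun i => le_iInf fun j => ?_)
    · refine (iInf_le _ i).trans ?_
      rw [← (hbr i).contact_eq hW.1]
      exact le_iSup₂ (f := fun W _ => (B i).contact W) W hW
    · refine (le_min (iInf_le _ i) ?_).trans
        (AlgebroidCurve.min_orderOfContact_le (hbr i) hW.1 (hbr j))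
      rw [AlgebroidCurve.orderOfContact_comm W]
      exact iInf_le _ j
  -- Working with t below the right-hand side avoids asking that the supremum d_k(C_0) be attained.
  · refine le_of_forall_lt_imp_le_of_dense fun t ht => ?_
    obtain ⟨h1, h2⟩ := lt_min_iff.1 ht
    let i₀ : Fin r := ⟨0, by omega⟩
    obtain ⟨W, hW⟩ := lt_iSup_iff.1 (h1.trans_le (iInf_le _ i₀))
    obtain ⟨hWk, hW⟩ := lt_iSup_iff.1 hW
    rw [(hbr i₀).contact_eq hWk.1] at hW
    refine le_trans ?_ (le_iSup₂ (f := fun W _ => C.contact W) W hWk)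
    rw [hcontact W hWk.1]
    refine le_iInf fun j => le_trans (le_min ?_ hW.le)
      (AlgebroidCurve.min_orderOfContact_le (hbr j) (hbr i₀) hWk.1)
    exact h2.le.trans ((iInf_le _ j).trans (iInf_le _ i₀))
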